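/- Let $n=6k$ with $k\ge 1$ an integer, and let $P_n$ be the vertex set of a regular $n$-gon inscribed in the unit circle of the Euclidean plane, with the Euclidean distance $d$. For $\epsilon\in\mathbb{R}$ let $\mathcal{R}_\epsilon(P_n)$ be the Vietoris–Rips complex whose simplices are the nonempty subsets $\{x_0,\dots,x_m\}\subseteq P_n$ with $\max_{i,j} d(x_i,x_j)<\epsilon$, and for $q\ge 0$ let $\mathsf{bcd}_q^{\mathcal{R}}(P_n)$ denote the barcode of the persistence module $\epsilon\mapsto H_q(\mathcal{R}_\epsilon(P_n);F)$ (unreduced simplicial homology with coefficients in an arbitrary field $F$, maps induced by inclusions), that is, the multiset of intervals such that this module is isomorphic to the direct sum of the corresponding interval modules. Then $$\mathsf{bcd}_0^{\mathcal{R}}(P_n)=\Bigl\{(0,\infty),\ \underbrace{\bigl(0,2\sin\tfrac{\pi}{n}\bigr],\dots,\bigl(0,2\sin\tfrac{\pi}{n}\bigr]}_{n-1\text{ times}}\Bigr\},\qquad \mathsf{bcd}_1^{\mathcal{R}}(P_n)=\Bigl\{\bigl(2\sin\tfrac{\pi}{n},\sqrt{3}\,\bigr]\Bigr\}.$$ 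-/

import Mathlib

open CategoryTheory

noncomputable section

/-! ### Persistence modules and barcodes -/

/-- The direct sum of the interval modules of a family `I` of intervals of the real line, as a
functor from the ordered set `ℝ` to vector spaces. Its value at `t` is the space of finitely
supported functions on the set of those indices `i` for which `t ∈ I i`; the map from `s` to `t`
is the identity on the summands alive at both `s` and `t`, and zero on the other ones. -/
def intervalSum (F : Type*) [Field F] {ι : Type} (I : ι → Set ℝ)
    (hI : ∀ i, (I i).OrdConnected) : ℝ ⥤ ModuleCat F where
  obj t := ModuleCat.of F (Finsupp.supported F F {i | t ∈ I i})
  map {s t} _ := by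
    classical
    exact ModuleCat.ofHom ((Finsupp.restrictDom F F {i | t ∈ I i}).comp
      (Finsupp.supported F F {i | s ∈ I i}).subtype)
  map_id t := by
    ext x : 2
    apply Subtype.ext
    classical
    exact (Finsupp.filter_eq_self_iff _ _).2 fun i hi =>
      (Finsupp.mem_supported F x.1).1 x.2 (Finsupp.mem_support_iff.2 hi)
  map_comp {s t u} f g := by
    classical
    ext x : 2
    apply Subtype.ext
    ext i
    by_cases hs : s ∈ I i
    · by_cases hu : u ∈ I i
      · have ht : t ∈ I i := (hI i).out hs hu ⟨leOfHom f, leOfHom g⟩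
        simp [hu, ht]
      · simp [hu]
    · have hx : x.1 i = 0 := by
        by_contra h
        exact hs ((Finsupp.mem_supported F x.1).1 x.2 (Finsupp.mem_support_iff.2 h))
      simp [Finsupp.filter_apply, hx]

/-- The finite multiset `B` of subsets of `ℝ` is the barcode of the persistence module `M`:
all members of `B` are nonempty intervals, and `M` is isomorphic to the direct sum of their
interval modules. -/
def IsBarcode {F : Type*} [Field F] (M : ℝ ⥤ ModuleCat F) (B : Multiset (Set ℝ)) : Prop :=
  ∃ (ι : Type) (_ : Fintype ι) (I : ι → Set ℝ) (hI : ∀ i, (I i).OrdConnected),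
    (∀ i, (I i).Nonempty) ∧ Finset.univ.val.map I = B ∧ Nonempty (M ≅ intervalSum F I hI)

/-- The rank of a structure map of a finite direct sum of interval modules is the number of
intervals containing both parameters. -/
theorem finrank_range_intervalSum_map (F : Type*) [Field F] {ι : Type} [Fintype ι]
    (I : ι → Set ℝ) (hI : ∀ i, (I i).OrdConnected) {s t : ℝ} (f : s ⟶ t) :
    Module.finrank F (LinearMap.range ((intervalSum F I hI).map f).hom) =
      Nat.card {i | s ∈ I i ∧ t ∈ I i} := by
  classical
  have key : (LinearMap.range ((intervalSum F I hI).map f).hom).map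
      (Finsupp.supported F F {i | t ∈ I i}).subtype =
      Finsupp.supported F F {i | s ∈ I i ∧ t ∈ I i} := by
    ext y
    constructor
    · rintro ⟨_, ⟨x, rfl⟩, rfl⟩
      rw [Finsupp.mem_supported]
      intro i hi
      have hi' : (Finsupp.filter (· ∈ {i | t ∈ I i}) x.1) i ≠ 0 := Finsupp.mem_support_iff.1 hi
      rw [Finsupp.filter_apply] at hi'
      split_ifs at hi' with h
      · exact ⟨(Finsupp.mem_supported F x.1).1 x.2 (Finsupp.mem_support_iff.2 hi'), h⟩
      · exact absurd rfl hi'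
    · intro hy
      rw [Finsupp.mem_supported] at hy
      refine ⟨⟨y, (Finsupp.mem_supported F y).2 fun i hi => (hy hi).2⟩,
        ⟨⟨y, (Finsupp.mem_supported F y).2 fun i hi => (hy hi).1⟩, ?_⟩, rfl⟩
      apply Subtype.ext
      exact (Finsupp.filter_eq_self_iff _ _).2 fun i hi => (hy (Finsupp.mem_support_iff.2 hi)).2
  have h1 := (Submodule.equivMapOfInjective (Finsupp.supported F F {i | t ∈ I i}).subtype
    (Submodule.subtype_injective _) (LinearMap.range ((intervalSum F I hI).map f).hom)).finrank_eq
  refine h1.trans ?_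
  refine (congrArg (fun S : Submodule F (ι →₀ F) => Module.finrank F S) key).trans ?_
  rw [(Finsupp.supportedEquivFinsupp (M := F) (R := F) {i | s ∈ I i ∧ t ∈ I i}).finrank_eq,
    Module.finrank_finsupp_self, Nat.card_eq_fintype_card]

open Classical in
/-- A finite multiset of nonempty intervals is determined by the numbers of its members which
contain two given points. -/
theorem intervals_eq_of_countP_eq (n : ℕ) (A B : Multiset (Set ℝ)) (hn : A.card + B.card ≤ n)
    (hA : ∀ I ∈ A, I.Nonempty ∧ I.OrdConnected) (hB : ∀ I ∈ B, I.Nonempty ∧ I.OrdConnected)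
    (h : ∀ s t : ℝ, s ≤ t → A.countP (fun I => s ∈ I ∧ t ∈ I) =
      B.countP (fun I => s ∈ I ∧ t ∈ I)) : A = B := by
  classical
  induction n generalizing A B with
  | zero =>
    have h1 : A = 0 := Multiset.card_eq_zero.1 (by omega)
    have h2 : B = 0 := Multiset.card_eq_zero.1 (by omega)
    rw [h1, h2]
  | succ n ih =>
    rcases (A + B).toFinset.eq_empty_or_nonempty with he | hne
    · have h0 := Multiset.toFinset_eq_empty.1 he
      have hc := congrArg Multiset.card h0
      rw [Multiset.card_add, Multiset.card_zero] at hc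
      exact ih A B (by omega) hA hB h
    · obtain ⟨J, hJ⟩ := (A + B).toFinset.exists_maximal hne
      have hJmem : J ∈ A + B := Multiset.mem_toFinset.1 hJ.1
      have hall : ∀ I ∈ A + B, I.Nonempty ∧ I.OrdConnected := fun I hI =>
        (Multiset.mem_add.1 hI).elim (hA I) (hB I)
      have hp : ∀ K : Set ℝ, ∃ p ∈ J, K ∈ A + B → K ≠ J → p ∉ K := by
        intro K
        by_cases hK : K ∈ A + B ∧ K ≠ J
        · have : ¬ J ⊆ K := fun hs =>
            hK.2 (le_antisymm (hJ.2 (Multiset.mem_toFinset.2 hK.1) hs) hs)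
          obtain ⟨p, hpJ, hpK⟩ := Set.not_subset.1 this
          exact ⟨p, hpJ, fun _ _ => hpK⟩
        · obtain ⟨p, hpJ⟩ := (hall J hJmem).1
          exact ⟨p, hpJ, fun h1 h2 => absurd ⟨h1, h2⟩ hK⟩
      choose p hpJ hpK using hp
      set P := (A + B).toFinset.image p with hPdef
      have hPne : P.Nonempty := hne.image p
      have hPJ : ∀ x ∈ P, x ∈ J := by
        intro x hx
        obtain ⟨K, _, rfl⟩ := Finset.mem_image.1 hx
        exact hpJ K
      have hsJ := hPJ _ (P.min'_mem hPne)
      have htJ := hPJ _ (P.max'_mem hPne)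
      have hst : P.min' hPne ≤ P.max' hPne := P.min'_le _ (P.max'_mem hPne)
      have hiff : ∀ K ∈ A + B, (P.min' hPne ∈ K ∧ P.max' hPne ∈ K) ↔ J = K := by
        intro K hK
        constructor
        · rintro ⟨h1, h2⟩
          by_contra hne'
          have hm : p K ∈ P := Finset.mem_image_of_mem p (Multiset.mem_toFinset.2 hK)
          exact hpK K hK (Ne.symm hne')
            ((hall K hK).2.out h1 h2 ⟨P.min'_le _ hm, P.le_max' _ hm⟩)
        · rintro rfl
          exact ⟨hsJ, htJ⟩
      have hcount : A.count J = B.count J := by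
        have := h _ _ hst
        rw [Multiset.countP_congr rfl
            (fun K hK => propext (hiff K (Multiset.mem_add.2 (Or.inl hK)))),
          Multiset.countP_congr (s := B) rfl
            (fun K hK => propext (hiff K (Multiset.mem_add.2 (Or.inr hK))))] at this
        exact this
      have hJA : J ∈ A := by
        rcases Multiset.mem_add.1 hJmem with h1 | h1
        · exact h1
        · rw [← Multiset.count_pos] at h1 ⊢
          omega
      have hJB : J ∈ B := by
        rw [← Multiset.count_pos] at hJA ⊢
        omega
      obtain ⟨A', rfl⟩ := Multiset.exists_cons_of_mem hJA
      obtain ⟨B', rfl⟩ := Multiset.exists_cons_of_mem hJB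
      rw [Multiset.card_cons, Multiset.card_cons] at hn
      rw [ih A' B' (by omega) (fun I hI => hA I (Multiset.mem_cons_of_mem hI))
        (fun I hI => hB I (Multiset.mem_cons_of_mem hI))]
      intro s t hst
      have := h s t hst
      rw [Multiset.countP_cons, Multiset.countP_cons] at this
      omega

/-- A persistence module has at most one barcode. -/
theorem IsBarcode.unique {F : Type*} [Field F] {M : ℝ ⥤ ModuleCat F} {A B : Multiset (Set ℝ)}
    (hA : IsBarcode M A) (hB : IsBarcode M B) : A = B := by
  classical
  have key : ∀ C : Multiset (Set ℝ), IsBarcode M C →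
      (∀ I ∈ C, I.Nonempty ∧ I.OrdConnected) ∧ ∀ s t : ℝ, ∀ h : s ≤ t,
        C.countP (fun I => s ∈ I ∧ t ∈ I) =
          Module.finrank F (LinearMap.range (M.map (homOfLE h)).hom) := by
    rintro _ ⟨ι, hι, I, hI, hne, rfl, ⟨e⟩⟩
    refine ⟨?_, ?_⟩
    · intro J hJ
      obtain ⟨i, -, rfl⟩ := Multiset.mem_map.1 hJ
      exact ⟨hne i, hI i⟩
    · intro s t h
      have hnat := e.hom.naturality (homOfLE h)
      have h1 : LinearMap.range ((intervalSum F I hI).map (homOfLE h)).hom =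
          (LinearMap.range (M.map (homOfLE h)).hom).map (e.app t).toLinearEquiv.toLinearMap := by
        have h2 := congrArg (fun g => LinearMap.range g.hom) hnat
        simp only [ModuleCat.hom_comp, LinearMap.range_comp] at h2
        have h3 : LinearMap.range (e.hom.app s).hom = ⊤ :=
          LinearMap.range_eq_top.2 (e.app s).toLinearEquiv.surjective
        rw [h3, Submodule.map_top] at h2
        exact h2.symm
      have h4 := finrank_range_intervalSum_map F I hI (homOfLE h)
      rw [h1, LinearEquiv.finrank_map_eq] at h4
      rw [h4, Multiset.countP_map, Nat.card_eq_fintype_card, Fintype.card_subtype]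
      rfl
  obtain ⟨hA1, hA2⟩ := key A hA
  obtain ⟨hB1, hB2⟩ := key B hB
  exact intervals_eq_of_countP_eq _ A B le_rfl hA1 hB1
    fun s t h => (hA2 s t h).trans (hB2 s t h).symm

/-! ### Simplicial homology -/

/-- An ordered `n`-simplex of a simplicial complex: a tuple `(v₀, …, vₙ)` of vertices,
repetitions allowed, such that `{v₀, …, vₙ}` is a face. -/
def OrderedSimplex {V : Type} (K : PreAbstractSimplicialComplex V) (n : ℕ) : Type :=
  {v : Fin (n + 1) → V // ∃ s ∈ K.faces, (s : Set V) = Set.range v}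

/-- The `i`-th face of an ordered simplex, obtained by omitting the `i`-th vertex. -/
def OrderedSimplex.face {V : Type} {K : PreAbstractSimplicialComplex V} {n : ℕ}
    (i : Fin (n + 2)) (v : OrderedSimplex K (n + 1)) : OrderedSimplex K n :=
  ⟨fun j => v.1 (i.succAbove j), by
    classical
    obtain ⟨s, hs, hsv⟩ := v.2
    refine ⟨Finset.univ.image fun j => v.1 (i.succAbove j), ?_, by simp⟩
    refine (K.isRelLowerSet_faces hs).2 ?_ ⟨_, Finset.mem_image_of_mem _ (Finset.mem_univ 0)⟩
    intro x hx
    obtain ⟨j, -, rfl⟩ := Finset.mem_image.1 hx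
    exact Finset.mem_coe.1 (hsv ▸ Set.mem_range_self _)⟩

/-- An ordered simplex of a subcomplex, as a simplex of the larger complex. -/
def OrderedSimplex.incl {V : Type} {K L : PreAbstractSimplicialComplex V} (h : K ≤ L) {n : ℕ}
    (v : OrderedSimplex K n) : OrderedSimplex L n :=
  ⟨v.1, v.2.imp fun _ hs => ⟨h hs.1, hs.2⟩⟩

/-- The space of ordered simplicial `n`-chains with coefficients in `F`. -/
abbrev SimplicialChain (F : Type*) [Field F] {V : Type} (K : PreAbstractSimplicialComplex V)
    (n : ℕ) : Type _ :=
  OrderedSimplex K n →₀ F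

/-- The boundary `∂ (v₀, …, vₙ₊₁) = ∑ i, (-1)ⁱ (v₀, …, v̂ᵢ, …, vₙ₊₁)`. -/
def simplicialBoundary (F : Type*) [Field F] {V : Type} (K : PreAbstractSimplicialComplex V)
    (n : ℕ) : SimplicialChain F K (n + 1) →ₗ[F] SimplicialChain F K n :=
  ∑ i : Fin (n + 2), (-1 : F) ^ (i : ℕ) • Finsupp.lmapDomain F F (OrderedSimplex.face i)

theorem simplicialBoundary_comp (F : Type*) [Field F] {V : Type}
    (K : PreAbstractSimplicialComplex V) (n : ℕ) :
    simplicialBoundary F K n ∘ₗ simplicialBoundary F K (n + 1) = 0 := by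
  classical
  refine Finsupp.lhom_ext' fun v => LinearMap.ext_ring ?_
  have hface : ∀ (j : Fin (n + 3)) (i : Fin (n + 2)),
      OrderedSimplex.face (i.predAbove j) (OrderedSimplex.face (j.succAbove i) v) =
        OrderedSimplex.face i (OrderedSimplex.face j v) := fun j i =>
    Subtype.ext (funext fun k =>
      congrArg v.1 (Fin.succAbove_succAbove_succAbove_predAbove j i k))
  simp only [simplicialBoundary, LinearMap.comp_apply, LinearMap.sum_apply, LinearMap.smul_apply,
    Finsupp.lsingle_apply, Finsupp.lmapDomain_apply, Finsupp.mapDomain_single, map_sum, map_smul,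
    LinearMap.zero_apply, Finset.smul_sum, smul_smul]
  rw [Finset.sum_comm, ← Finset.sum_product']
  refine Finset.sum_involution
    (fun p _ => (p.1.predAbove p.2, p.2.succAbove p.1)) ?_ ?_ ?_ ?_
  · rintro ⟨i, j⟩ -
    simp only [hface]
    rw [← add_smul]
    have := Fin.neg_one_pow_succAbove_add_predAbove (R := F) j i
    rw [pow_add, pow_add] at this
    rw [this, add_neg_cancel, zero_smul]
  · rintro ⟨i, j⟩ - - h
    exact Fin.succAbove_ne j i (Prod.ext_iff.1 h).2
  · intros
    simp
  · rintro ⟨i, j⟩ -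
    exact Prod.ext (Fin.predAbove_predAbove_succAbove j i) (Fin.succAbove_succAbove_predAbove j i)

/-- The `n`-cycles; all `0`-chains are cycles (the homology is not reduced). -/
def simplicialCycles (F : Type*) [Field F] {V : Type} (K : PreAbstractSimplicialComplex V) :
    (n : ℕ) → Submodule F (SimplicialChain F K n)
  | 0 => ⊤
  | n + 1 => LinearMap.ker (simplicialBoundary F K n)

/-- The `n`-boundaries. -/
def simplicialBoundaries (F : Type*) [Field F] {V : Type} (K : PreAbstractSimplicialComplex V)
    (n : ℕ) : Submodule F (SimplicialChain F K n) :=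
  LinearMap.range (simplicialBoundary F K n)

theorem simplicialBoundaries_le_cycles (F : Type*) [Field F] {V : Type}
    (K : PreAbstractSimplicialComplex V) (n : ℕ) :
    simplicialBoundaries F K n ≤ simplicialCycles F K n := by
  cases n with
  | zero => exact le_top
  | succ n => exact LinearMap.range_le_ker_iff.2 (simplicialBoundary_comp F K n)

/-- The quotient `Z / (B ∩ Z)` for submodules `Z` and `B` of a module. -/
abbrev Subquotient {F M : Type*} [Field F] [AddCommGroup M] [Module F M]
    (Z B : Submodule F M) : Type _ :=
  Z ⧸ B.submoduleOf Z

/-- The map of subquotients induced by a linear map. -/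
def subquotientMap {F M N : Type*} [Field F] [AddCommGroup M] [Module F M] [AddCommGroup N]
    [Module F N] {Z B : Submodule F M} {Z' B' : Submodule F N} (f : M →ₗ[F] N)
    (hZ : Z ≤ Z'.comap f) (hB : B ≤ B'.comap f) : Subquotient Z B →ₗ[F] Subquotient Z' B' :=
  Submodule.mapQ _ _ (f.restrict hZ) fun _ hx => hB hx

/-- The `n`-th simplicial homology: cycles modulo boundaries. -/
abbrev SimplicialHomology (F : Type*) [Field F] {V : Type} (K : PreAbstractSimplicialComplex V)
    (n : ℕ) : Type _ :=
  Subquotient (simplicialCycles F K n) (simplicialBoundaries F K n)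

/-- The map of chains induced by an inclusion of complexes. -/
def simplicialChainMap (F : Type*) [Field F] {V : Type} {K L : PreAbstractSimplicialComplex V}
    (h : K ≤ L) (n : ℕ) : SimplicialChain F K n →ₗ[F] SimplicialChain F L n :=
  Finsupp.lmapDomain F F (OrderedSimplex.incl h)

theorem simplicialBoundary_chainMap (F : Type*) [Field F] {V : Type}
    {K L : PreAbstractSimplicialComplex V} (h : K ≤ L) (n : ℕ) (c : SimplicialChain F K (n + 1)) :
    simplicialBoundary F L n (simplicialChainMap F h (n + 1) c) =
      simplicialChainMap F h n (simplicialBoundary F K n c) := by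
  simp only [simplicialBoundary, simplicialChainMap, LinearMap.sum_apply, LinearMap.smul_apply,
    Finsupp.lmapDomain_apply, map_sum, map_smul, ← Finsupp.mapDomain_comp]
  rfl

theorem simplicialCycles_le_comap (F : Type*) [Field F] {V : Type}
    {K L : PreAbstractSimplicialComplex V} (h : K ≤ L) (n : ℕ) :
    simplicialCycles F K n ≤ (simplicialCycles F L n).comap (simplicialChainMap F h n) := by
  cases n with
  | zero => exact fun _ _ => Submodule.mem_top
  | succ n =>
    intro c hc
    have hc' : simplicialBoundary F K n c = 0 := hc
    change simplicialBoundary F L n _ = 0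
    rw [simplicialBoundary_chainMap, hc', map_zero]

theorem simplicialBoundaries_le_comap (F : Type*) [Field F] {V : Type}
    {K L : PreAbstractSimplicialComplex V} (h : K ≤ L) (n : ℕ) :
    simplicialBoundaries F K n ≤
      (simplicialBoundaries F L n).comap (simplicialChainMap F h n) := by
  rintro _ ⟨b, rfl⟩
  exact ⟨simplicialChainMap F h (n + 1) b, simplicialBoundary_chainMap F h n b⟩

/-- The map of homology induced by an inclusion of complexes. -/
def simplicialHomologyMap (F : Type*) [Field F] {V : Type} {K L : PreAbstractSimplicialComplex V}
    (h : K ≤ L) (n : ℕ) : SimplicialHomology F K n →ₗ[F] SimplicialHomology F L n :=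
  subquotientMap (simplicialChainMap F h n) (simplicialCycles_le_comap F h n)
    (simplicialBoundaries_le_comap F h n)

/-! ### The Vietoris–Rips filtration and regular polygons -/

/-- The Vietoris–Rips complex at scale `ε`: its faces are the nonempty finite sets all of whose
pairwise distances, `dist x x = 0` included, are smaller than `ε`. -/
def vietorisRips (X : Type) [MetricSpace X] (ε : ℝ) : PreAbstractSimplicialComplex X where
  faces := {s | s.Nonempty ∧ ∀ x ∈ s, ∀ y ∈ s, dist x y < ε}
  isRelLowerSet_faces := fun _ hs =>
    ⟨hs.1, fun _ hts ht => ⟨ht, fun x hx y hy => hs.2 x (hts hx) y (hts hy)⟩⟩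

theorem vietorisRips_mono (X : Type) [MetricSpace X] {ε ε' : ℝ} (h : ε ≤ ε') :
    vietorisRips X ε ≤ vietorisRips X ε' :=
  fun _ hs => ⟨hs.1, fun x hx y hy => (hs.2 x hx y hy).trans_le h⟩

/-- The `n`-dimensional persistent homology of the Vietoris–Rips filtration of `X`. -/
def ripsPersistentHomology (F : Type*) [Field F] (X : Type) [MetricSpace X] (n : ℕ) :
    ℝ ⥤ ModuleCat F where
  obj ε := ModuleCat.of F (SimplicialHomology F (vietorisRips X ε) n)
  map f := ModuleCat.ofHom (simplicialHomologyMap F (vietorisRips_mono X (leOfHom f)) n)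
  map_id ε := by
    refine ModuleCat.hom_ext (LinearMap.ext fun x => ?_)
    obtain ⟨c, rfl⟩ := Submodule.mkQ_surjective _ x
    exact congrArg (Submodule.mkQ _) (Subtype.ext Finsupp.mapDomain_id)
  map_comp f g := by
    refine ModuleCat.hom_ext (LinearMap.ext fun x => ?_)
    obtain ⟨c, rfl⟩ := Submodule.mkQ_surjective _ x
    exact congrArg (Submodule.mkQ _) (Subtype.ext (Finsupp.mapDomain_comp (v := c.1)
      (f := OrderedSimplex.incl (vietorisRips_mono X (leOfHom f)))
      (g := OrderedSimplex.incl (vietorisRips_mono X (leOfHom g)))))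

/-- The vertices of the regular `n`-gon inscribed in the unit circle of the Euclidean plane. -/
def regularPolygon (n : ℕ) : Set ℂ :=
  Set.range fun j : Fin n => Complex.exp ((2 * Real.pi * (j : ℕ) / n : ℝ) * Complex.I)

end

/-!
Write `ℓ m` for the length of a chord of the unit circle joining two vertices of the regular
`n`-gon which are `m ≤ n / 2` steps apart (`chordLength`). It increases with `m`, so that with each
chord a Vietoris–Rips complex of the polygon contains all chords between vertices of its shorter
arc. Three events determine the homology: at `ε = 0` the vertices appear, just after `ε = ℓ 1` the
sides appear, and, since `n` is a multiple of six, just after `ε = √3 = ℓ (n / 3)` the inscribed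
equilateral triangles appear.

In both dimensions explicit cycles are exhibited whose classes form bases of all the homology
spaces, compatibly with the inclusions; by `isBarcode_of_cycles` this gives the barcode. Linear
independence is witnessed by cocycles.

In dimension zero the cycles are one vertex, detected by the augmentation, and the differences of
the other vertices to it. The latter are detected by the coordinate functions as long as the complex
is discrete, and become boundaries with the sides.

In dimension one the cycle is the closed polygon.
* After `ℓ 1` it spans the homology (`exists_sub_smul_polygonChain_mem`). A chord is equivalent,
  modulo boundaries, to the path of sides along its shorter arc; hence every cycle is equivalent to
  a combination of sides, and a combination of sides is a cycle only if its coefficients agree.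
* Up to `√3` it is detected by the cochain which counts how often an edge, lifted to its shorter
  arc, passes a base point. This is a cocycle because three arcs of fewer than `n / 3` steps cannot
  close up to a full circle (`isCocycle_crossingCochain`). The count is one on the polygon, so no
  condition on the characteristic of the field is needed.
* After `√3` the polygon is equivalent to the boundary of an inscribed equilateral triangle, hence a
  boundary (`polygonChain_mem_boundaries`).
-/

noncomputable section

/-! ### Recognizing a barcode -/

/-- If elements `y t i` of a persistence module are carried to each other by the structure maps,
vanish outside the intervals `I i`, span each space, and are separated by functionals inside
their intervals, then the module is the direct sum of the interval modules of the `I i`. -/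
theorem isBarcode_of_dual_family {F : Type*} [Field F] (M : ℝ ⥤ ModuleCat F) {ι : Type}
    [Fintype ι] (I : ι → Set ℝ) (hI : ∀ i, (I i).OrdConnected) (hne : ∀ i, (I i).Nonempty)
    (y : ∀ t, ι → M.obj t)
    (hmap : ∀ (s t : ℝ) (f : s ⟶ t), ∀ i, s ∈ I i → (M.map f).hom (y s i) = y t i)
    (hzero : ∀ t i, t ∉ I i → y t i = 0)
    (hspan : ∀ t, ⊤ ≤ Submodule.span F (Set.range (y t)))
    (hdual : ∀ t i, t ∈ I i → ∃ φ : M.obj t →ₗ[F] F, φ (y t i) = 1 ∧ ∀ j ≠ i, φ (y t j) = 0) :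
    IsBarcode M (Finset.univ.val.map I) := by
  classical
  refine ⟨ι, inferInstance, I, hI, hne, rfl, ⟨Iso.symm ?_⟩⟩
  let T : ∀ t, Finsupp.supported F F {i | t ∈ I i} →ₗ[F] M.obj t := fun t =>
    (Finsupp.linearCombination F (y t)).comp (Submodule.subtype _)
  have hlc : ∀ t (c : ι →₀ F), Finsupp.linearCombination F (y t) c = ∑ i, c i • y t i :=
    fun t c => by rw [Finsupp.linearCombination_apply, Finsupp.sum_fintype _ _ (by simp)]
  have hfilter : ∀ t (c : ι →₀ F), Finsupp.linearCombination F (y t)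
      (Finsupp.filter (· ∈ {i | t ∈ I i}) c) = ∑ i, c i • y t i := by
    intro t c
    rw [hlc]
    refine Finset.sum_congr rfl fun i _ => ?_
    by_cases hi : t ∈ I i
    · exact congrArg (· • y t i) (Finsupp.filter_apply_pos (· ∈ {i | t ∈ I i}) c hi)
    · rw [hzero t i hi, smul_zero, smul_zero]
  have hsupp : ∀ t (x : Finsupp.supported F F {i | t ∈ I i}) i, t ∉ I i → x.1 i = 0 :=
    fun t x i hi => by
      by_contra h
      exact hi ((Finsupp.mem_supported F x.1).1 x.2 (Finsupp.mem_support_iff.2 h))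
  have hinj : ∀ t, Function.Injective (T t) := by
    intro t x x' hx
    refine Subtype.ext (Finsupp.ext fun i => ?_)
    by_cases hi : t ∈ I i
    · obtain ⟨φ, h1, h0⟩ := hdual t i hi
      have hφ : ∀ c : ι →₀ F, φ (Finsupp.linearCombination F (y t) c) = c i := by
        intro c
        rw [hlc, map_sum, Finset.sum_eq_single i]
        · rw [map_smul, h1, smul_eq_mul, mul_one]
        · intro j _ hj
          rw [map_smul, h0 j hj, smul_zero]
        · simp
      rw [← hφ x.1, ← hφ x'.1]
      exact congrArg φ hx
    · rw [hsupp t x i hi, hsupp t x' i hi]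
  have hsurj : ∀ t, Function.Surjective (T t) := by
    intro t m
    obtain ⟨c, hc⟩ := (Submodule.mem_span_range_iff_exists_fun F).1
      (hspan t (Submodule.mem_top (x := m)))
    refine ⟨Finsupp.restrictDom F F {i | t ∈ I i} (Finsupp.equivFunOnFinite.symm c), ?_⟩
    exact (hfilter t _).trans hc
  refine NatIso.ofComponents
    (fun t => (LinearEquiv.ofBijective (T t) ⟨hinj t, hsurj t⟩).toModuleIso) ?_
  intro s t f
  refine ModuleCat.hom_ext (LinearMap.ext fun (x : Finsupp.supported F F {i | s ∈ I i}) => ?_)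
  change Finsupp.linearCombination F (y t) (Finsupp.filter (· ∈ {i | t ∈ I i}) x.1) =
    (M.map f).hom (Finsupp.linearCombination F (y s) x.1)
  rw [hfilter, hlc, map_sum]
  refine Finset.sum_congr rfl fun i _ => ?_
  rw [map_smul]
  by_cases hs : s ∈ I i
  · rw [hmap s t f i hs]
  · rw [hsupp s x i hs, zero_smul, zero_smul]

/-! ### Chains and cochains of Vietoris–Rips complexes -/

section Rips

variable {F : Type*} [Field F] {X : Type} [MetricSpace X] {ε : ℝ} {m : ℕ}

/-- All distances between entries of the tuple `v` are smaller than `ε`, so that `v` is an ordered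
simplex of the Vietoris–Rips complex at scale `ε`. -/
def IsSmallTuple (ε : ℝ) (v : Fin m → X) : Prop :=
  ∀ i j, dist (v i) (v j) < ε

theorem IsSmallTuple.comp {l : ℕ} {v : Fin m → X} (h : IsSmallTuple ε v) (f : Fin l → Fin m) :
    IsSmallTuple ε (fun j => v (f j)) :=
  fun i j => h (f i) (f j)

theorem isSmallTuple_of_orderedSimplex (v : OrderedSimplex (vietorisRips X ε) m) :
    IsSmallTuple ε v.1 := by
  obtain ⟨s, hs, hsv⟩ := v.2
  exact fun i j => hs.2 _ (Finset.mem_coe.1 (hsv ▸ Set.mem_range_self i)) _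
    (Finset.mem_coe.1 (hsv ▸ Set.mem_range_self j))

/-- A small tuple as an ordered simplex. -/
def IsSmallTuple.simplex {v : Fin (m + 1) → X} (h : IsSmallTuple ε v) :
    OrderedSimplex (vietorisRips X ε) m :=
  ⟨v, by
    classical
    refine ⟨Finset.univ.image v, ⟨⟨_, Finset.mem_image_of_mem _ (Finset.mem_univ 0)⟩, ?_⟩, by simp⟩
    intro x hx y hy
    obtain ⟨i, -, rfl⟩ := Finset.mem_image.1 hx
    obtain ⟨j, -, rfl⟩ := Finset.mem_image.1 hy
    exact h i j⟩

open Classical in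
/-- The chain consisting of the ordered simplex `v` at scale `ε`; it is zero if `v` is not a
simplex at that scale. -/
def tupleChain (F : Type*) [Field F] (ε : ℝ) (v : Fin (m + 1) → X) :
    SimplicialChain F (vietorisRips X ε) m :=
  if h : IsSmallTuple ε v then Finsupp.single h.simplex 1 else 0

theorem tupleChain_of_small {v : Fin (m + 1) → X} (h : IsSmallTuple ε v) :
    tupleChain F ε v = Finsupp.single h.simplex 1 :=
  dif_pos h

theorem tupleChain_of_not_small {v : Fin (m + 1) → X} (h : ¬ IsSmallTuple ε v) :
    tupleChain F ε v = 0 :=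
  dif_neg h

theorem chain_mem_of_tupleChain_mem (S : Submodule F (SimplicialChain F (vietorisRips X ε) m))
    (h : ∀ v : Fin (m + 1) → X, IsSmallTuple ε v → tupleChain F ε v ∈ S)
    (c : SimplicialChain F (vietorisRips X ε) m) : c ∈ S := by
  induction c using Finsupp.induction_linear with
  | zero => exact S.zero_mem
  | add a b ha hb => exact S.add_mem ha hb
  | single v a =>
    have h1 := S.smul_mem a (h v.1 (isSmallTuple_of_orderedSimplex v))
    rw [tupleChain_of_small (isSmallTuple_of_orderedSimplex v), Finsupp.smul_single, smul_eq_mul,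
      mul_one] at h1
    exact h1

theorem simplicialBoundary_tupleChain {v : Fin (m + 2) → X} (h : IsSmallTuple ε v) :
    simplicialBoundary F (vietorisRips X ε) m (tupleChain F ε v) =
      ∑ i : Fin (m + 2), (-1 : F) ^ (i : ℕ) • tupleChain F ε (fun j => v (i.succAbove j)) := by
  rw [tupleChain_of_small h, simplicialBoundary, LinearMap.sum_apply]
  refine Finset.sum_congr rfl fun i _ => ?_
  rw [tupleChain_of_small (h.comp i.succAbove), LinearMap.smul_apply, Finsupp.lmapDomain_apply,
    Finsupp.mapDomain_single]
  rfl

theorem simplicialChainMap_tupleChain {s t : ℝ} (hst : s ≤ t) {v : Fin (m + 1) → X}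
    (h : IsSmallTuple s v) :
    simplicialChainMap F (vietorisRips_mono X hst) m (tupleChain F s v) = tupleChain F t v := by
  have ht : IsSmallTuple t v := fun i j => (h i j).trans_le hst
  rw [tupleChain_of_small h, tupleChain_of_small ht, simplicialChainMap,
    Finsupp.lmapDomain_apply, Finsupp.mapDomain_single]
  rfl

/-- Evaluation of chains on a cochain, given by its values on tuples. -/
def evalCochain (ε : ℝ) (w : (Fin (m + 1) → X) → F) :
    SimplicialChain F (vietorisRips X ε) m →ₗ[F] F :=
  Finsupp.linearCombination F fun v => w v.1

theorem evalCochain_tupleChain (w : (Fin (m + 1) → X) → F) {v : Fin (m + 1) → X}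
    (h : IsSmallTuple ε v) : evalCochain ε w (tupleChain F ε v) = w v := by
  rw [tupleChain_of_small h, evalCochain, Finsupp.linearCombination_single, one_smul]
  rfl

/-- A cochain is a cocycle at scale `ε` if it kills the boundaries of all simplices. -/
def IsCocycle (ε : ℝ) (w : (Fin (m + 1) → X) → F) : Prop :=
  ∀ v : Fin (m + 2) → X, IsSmallTuple ε v →
    ∑ i : Fin (m + 2), (-1 : F) ^ (i : ℕ) * w (fun j => v (i.succAbove j)) = 0

theorem IsCocycle.evalCochain_boundary {w : (Fin (m + 1) → X) → F} (hw : IsCocycle ε w)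
    {c : SimplicialChain F (vietorisRips X ε) m}
    (hc : c ∈ simplicialBoundaries F (vietorisRips X ε) m) : evalCochain ε w c = 0 := by
  obtain ⟨b, rfl⟩ := hc
  refine chain_mem_of_tupleChain_mem
    (LinearMap.ker ((evalCochain ε w).comp (simplicialBoundary F (vietorisRips X ε) m))) ?_ b
  intro v hv
  rw [LinearMap.mem_ker, LinearMap.comp_apply, simplicialBoundary_tupleChain hv, map_sum]
  refine Eq.trans (Finset.sum_congr rfl fun i _ => ?_) (hw v hv)
  rw [map_smul, evalCochain_tupleChain w (hv.comp i.succAbove), smul_eq_mul]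

/-- The functional on homology defined by a cocycle. -/
def IsCocycle.functional {w : (Fin (m + 1) → X) → F} (hw : IsCocycle ε w) :
    SimplicialHomology F (vietorisRips X ε) m →ₗ[F] F :=
  Submodule.liftQ _ ((evalCochain ε w).comp (Submodule.subtype _))
    fun _ hx => hw.evalCochain_boundary hx

theorem top_le_span_subquotient {M : Type*} [AddCommGroup M] [Module F M] {Z B : Submodule F M}
    (hB : B ≤ Z) {ι : Type*} {c : ι → M} (hc : ∀ i, c i ∈ Z)
    (hspan : Z ≤ Submodule.span F (Set.range c) ⊔ B) :
    ⊤ ≤ Submodule.span F (Set.range fun i => (Submodule.mkQ (B.submoduleOf Z)) ⟨c i, hc i⟩) := by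
  have hle : Submodule.span F (Set.range c) ⊔ B ≤
      ((Submodule.span F (Set.range fun i => Submodule.mkQ (B.submoduleOf Z) ⟨c i, hc i⟩)).comap
        (Submodule.mkQ (B.submoduleOf Z))).map Z.subtype := by
    refine sup_le (Submodule.span_le.2 ?_) fun b hb => ?_
    · rintro _ ⟨i, rfl⟩
      exact ⟨⟨c i, hc i⟩, Submodule.subset_span ⟨i, rfl⟩, rfl⟩
    · have h0 : Submodule.mkQ (B.submoduleOf Z) ⟨b, hB hb⟩ = 0 :=
        (Submodule.Quotient.mk_eq_zero _).2 hb
      refine ⟨⟨b, hB hb⟩, ?_, rfl⟩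
      rw [SetLike.mem_coe, Submodule.mem_comap, h0]
      exact Submodule.zero_mem _
  intro x _
  obtain ⟨z, rfl⟩ := Submodule.mkQ_surjective (B.submoduleOf Z) x
  obtain ⟨z', hz', h⟩ := hle (hspan z.2)
  rw [← (Subtype.ext h : z' = z)]
  exact hz'

/-- Cycles `c t i` represent a barcode of the Vietoris–Rips filtration if each of them persists
from its birth on and is a boundary outside its interval `I i`, if they span the homology at each
scale, and if cocycles separate those which are alive. -/
theorem isBarcode_of_cycles {ι : Type} [Fintype ι] (I : ι → Set ℝ) (hI : ∀ i, (I i).OrdConnected)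
    (hne : ∀ i, (I i).Nonempty) (c : ∀ t : ℝ, ι → SimplicialChain F (vietorisRips X t) m)
    (hcycle : ∀ t i, c t i ∈ simplicialCycles F (vietorisRips X t) m)
    (hmap : ∀ (s t : ℝ) (h : s ≤ t), ∀ i, s ∈ I i →
      simplicialChainMap F (vietorisRips_mono X h) m (c s i) = c t i)
    (hzero : ∀ t i, t ∉ I i → c t i ∈ simplicialBoundaries F (vietorisRips X t) m)
    (hspan : ∀ t, simplicialCycles F (vietorisRips X t) m ≤
      Submodule.span F (Set.range (c t)) ⊔ simplicialBoundaries F (vietorisRips X t) m)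
    (hdual : ∀ t i, t ∈ I i → ∃ w : (Fin (m + 1) → X) → F, IsCocycle t w ∧
      evalCochain t w (c t i) = 1 ∧ ∀ j ≠ i, evalCochain t w (c t j) = 0) :
    IsBarcode (ripsPersistentHomology F X m) (Finset.univ.val.map I) := by
  let y : ∀ t, ι → SimplicialHomology F (vietorisRips X t) m := fun t i =>
    Submodule.mkQ _ ⟨c t i, hcycle t i⟩
  refine isBarcode_of_dual_family _ I hI hne y ?_ ?_ ?_ ?_
  · exact fun s t f i hs => congrArg (Submodule.mkQ _) (Subtype.ext (hmap s t (leOfHom f) i hs))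
  · exact fun t i ht => (Submodule.Quotient.mk_eq_zero _).2 (hzero t i ht)
  · intro t
    exact top_le_span_subquotient (simplicialBoundaries_le_cycles F _ m) (hcycle t) (hspan t)
  · intro t i ht
    obtain ⟨w, hw, h1, h0⟩ := hdual t i ht
    exact ⟨hw.functional, h1, h0⟩

end Rips

/-! ### The geometry of the regular polygon -/

section Polygon

/-- The length of a chord of the unit circle joining two vertices of the regular `n`-gon which are
`m` steps apart. -/
def chordLength (n m : ℕ) : ℝ :=
  2 * Real.sin (Real.pi * m / n)

theorem chordLength_one (n : ℕ) : chordLength n 1 = 2 * Real.sin (Real.pi / n) := by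
  rw [chordLength, Nat.cast_one, mul_one]

variable {n : ℕ} [NeZero n]

/-- The vertices of the regular `n`-gon, indexed counterclockwise by the integers modulo `n`. -/
def polygonVertex (a : ZMod n) : regularPolygon n :=
  ⟨ZMod.stdAddChar a, ⟨a.val, a.val_lt⟩, by
    rw [ZMod.stdAddChar_apply, ZMod.toCircle_apply]
    push_cast
    congr 1
    ring⟩

theorem polygonVertex_injective : Function.Injective (polygonVertex (n := n)) := by
  intro a b h
  have h' : (polygonVertex a : ℂ) = polygonVertex b := by rw [h]
  exact ZMod.injective_stdAddChar h'

theorem polygonVertex_surjective : Function.Surjective (polygonVertex (n := n)) := by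
  rintro ⟨_, j, rfl⟩
  refine ⟨((j : ℕ) : ZMod n), Subtype.ext ?_⟩
  change ZMod.stdAddChar _ = _
  have h := ZMod.stdAddChar_coe (N := n) ((j : ℕ) : ℤ)
  rw [Int.cast_natCast] at h
  rw [h]
  push_cast
  congr 1
  ring

theorem dist_polygonVertex_add {m : ℕ} (hm : 2 * m ≤ n) (a : ZMod n) :
    dist (polygonVertex a) (polygonVertex (a + (m : ZMod n))) = chordLength n m := by
  have hn : (0 : ℝ) < n := Nat.cast_pos.2 (NeZero.pos n)
  change dist (ZMod.stdAddChar a : ℂ) (ZMod.stdAddChar (a + (m : ZMod n))) = _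
  rw [dist_comm, dist_eq_norm, AddChar.map_add_eq_mul]
  have h1 : (ZMod.stdAddChar a : ℂ) * ZMod.stdAddChar (m : ZMod n) - ZMod.stdAddChar a =
      ZMod.stdAddChar a * (ZMod.stdAddChar (m : ZMod n) - 1) := by ring
  have h2 : ‖(ZMod.stdAddChar a : ℂ)‖ = 1 := by
    rw [ZMod.stdAddChar_apply]
    exact Circle.norm_coe _
  have h3 : (ZMod.stdAddChar (m : ZMod n) : ℂ) =
      Complex.exp (Complex.I * (2 * Real.pi * m / n : ℝ)) := by
    have h := ZMod.stdAddChar_coe (N := n) (m : ℤ)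
    rw [Int.cast_natCast] at h
    rw [h]
    push_cast
    congr 1
    ring
  rw [h1, norm_mul, h2, one_mul, h3, Complex.norm_exp_I_mul_ofReal_sub_one, chordLength,
    Real.norm_eq_abs, abs_of_nonneg]
  · congr 2
    ring
  · refine mul_nonneg zero_le_two (Real.sin_nonneg_of_nonneg_of_le_pi (by positivity) ?_)
    have : (2 * m : ℝ) ≤ n := by exact_mod_cast hm
    rw [div_div, div_le_iff₀ (by positivity)]
    nlinarith [Real.pi_pos]

theorem chordLength_lt {l m : ℕ} (h : l < m) (hm : 2 * m ≤ n) :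
    chordLength n l < chordLength n m := by
  have hn : (0 : ℝ) < n := Nat.cast_pos.2 (NeZero.pos n)
  have hlm : (l : ℝ) < m := by exact_mod_cast h
  have hmn : (2 * m : ℝ) ≤ n := by exact_mod_cast hm
  refine mul_lt_mul_of_pos_left (Real.sin_lt_sin_of_lt_of_le_pi_div_two ?_ ?_ ?_) two_pos
  · have : 0 ≤ Real.pi * l / n := by positivity
    linarith [Real.pi_pos]
  · rw [div_le_div_iff₀ hn two_pos]
    nlinarith [Real.pi_pos]
  · exact div_lt_div_of_pos_right (mul_lt_mul_of_pos_left hlm Real.pi_pos) hn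

theorem chordLength_le {l m : ℕ} (h : l ≤ m) (hm : 2 * m ≤ n) :
    chordLength n l ≤ chordLength n m := by
  rcases h.eq_or_lt with rfl | h
  · exact le_rfl
  · exact (chordLength_lt h hm).le

theorem dist_polygonVertex (a b : ZMod n) :
    dist (polygonVertex a) (polygonVertex b) = chordLength n (b - a).valMinAbs.natAbs := by
  have h2 : 2 * (b - a).valMinAbs.natAbs ≤ n := by
    have := (b - a).natAbs_valMinAbs_le
    omega
  have h := (b - a).natCast_natAbs_valMinAbs
  split_ifs at h
  · rw [← dist_polygonVertex_add h2 a, h, add_sub_cancel]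
  · rw [← dist_polygonVertex_add h2 b, h, neg_sub, add_sub_cancel, dist_comm]

theorem exists_steps (a b : ZMod n) :
    ∃ m : ℕ, 2 * m ≤ n ∧ (b = a + (m : ZMod n) ∨ a = b + (m : ZMod n)) := by
  refine ⟨(b - a).valMinAbs.natAbs, ?_, ?_⟩
  · have := (b - a).natAbs_valMinAbs_le
    omega
  · have h := (b - a).natCast_natAbs_valMinAbs
    split_ifs at h
    · left
      rw [h, add_sub_cancel]
    · right
      rw [h, neg_sub, add_sub_cancel]

theorem chordLength_third {k : ℕ} (hn : n = 6 * k) : chordLength n (2 * k) = Real.sqrt 3 := by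
  have hk : (k : ℝ) ≠ 0 := by
    have := NeZero.ne n
    exact_mod_cast (by omega : k ≠ 0)
  have : Real.pi * (2 * k : ℕ) / n = Real.pi / 3 := by
    rw [hn]
    push_cast
    field_simp
    norm_num
  rw [chordLength, this, Real.sin_pi_div_three]
  ring

/-- Vertices closer than a third of the way around are fewer than `n / 3` steps apart. -/
theorem three_mul_natAbs_lt {k : ℕ} (hn : n = 6 * k) {a b : ZMod n}
    (h : dist (polygonVertex a) (polygonVertex b) < Real.sqrt 3) :
    3 * (b - a).valMinAbs.natAbs < n := by
  by_contra h1
  rw [dist_polygonVertex, ← chordLength_third hn] at h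
  have := (b - a).natAbs_valMinAbs_le
  exact absurd (chordLength_le (n := n) (by omega : 2 * k ≤ (b - a).valMinAbs.natAbs) (by omega))
    h.not_ge

theorem chordLength_one_le_dist {a b : ZMod n} (h : a ≠ b) :
    chordLength n 1 ≤ dist (polygonVertex a) (polygonVertex b) := by
  rw [dist_polygonVertex]
  have h1 : (b - a).valMinAbs ≠ 0 := by
    rw [Ne, ZMod.valMinAbs_eq_zero, sub_eq_zero]
    exact h.symm
  have := (b - a).natAbs_valMinAbs_le
  exact chordLength_le (by omega) (by omega)

end Polygon

/-! ### Vertices, edges and triangles -/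

section LowDimensional

variable {F : Type*} [Field F] {X : Type} [MetricSpace X] {ε : ℝ}

/-- The `0`-chain consisting of the vertex `x`. -/
abbrev vertexChain (F : Type*) [Field F] (ε : ℝ) (x : X) :
    SimplicialChain F (vietorisRips X ε) 0 :=
  tupleChain F ε fun _ : Fin 1 => x

/-- The `1`-chain consisting of the edge from `x` to `y`, zero if `x` and `y` are too far apart. -/
abbrev edgeChain (F : Type*) [Field F] (ε : ℝ) (x y : X) :
    SimplicialChain F (vietorisRips X ε) 1 :=
  tupleChain F ε ![x, y]

theorem isSmallTuple_vertex (h : 0 < ε) (x : X) : IsSmallTuple ε fun _ : Fin 1 => x :=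
  fun _ _ => by rwa [dist_self]

theorem isSmallTuple_edge {x y : X} : IsSmallTuple ε ![x, y] ↔ dist x y < ε := by
  constructor
  · exact fun h => h 0 1
  · intro h
    have h0 : 0 < ε := dist_nonneg.trans_lt h
    simp [IsSmallTuple, Fin.forall_fin_two, h, h0, dist_comm y x]

theorem isSmallTuple_triangle {x y z : X} (hxy : dist x y < ε) (hyz : dist y z < ε)
    (hxz : dist x z < ε) : IsSmallTuple ε ![x, y, z] := by
  have h0 : 0 < ε := dist_nonneg.trans_lt hxy
  simp [IsSmallTuple, Fin.forall_fin_succ, hxy, hyz, hxz, h0, dist_comm y x, dist_comm z x,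
    dist_comm z y]

theorem simplicialBoundary_edgeChain {x y : X} (h : dist x y < ε) :
    simplicialBoundary F (vietorisRips X ε) 0 (edgeChain F ε x y) =
      vertexChain F ε y - vertexChain F ε x := by
  have h0 : (fun j : Fin 1 => ![x, y] ((0 : Fin 2).succAbove j)) = fun _ => y := by
    funext j; fin_cases j; rfl
  have h1 : (fun j : Fin 1 => ![x, y] ((1 : Fin 2).succAbove j)) = fun _ => x := by
    funext j; fin_cases j; rfl
  rw [simplicialBoundary_tupleChain (isSmallTuple_edge.2 h), Fin.sum_univ_two, h0, h1]
  simp [sub_eq_add_neg]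

theorem simplicialBoundary_triangle {x y z : X} (h : IsSmallTuple ε ![x, y, z]) :
    simplicialBoundary F (vietorisRips X ε) 1 (tupleChain F ε ![x, y, z]) =
      edgeChain F ε y z - edgeChain F ε x z + edgeChain F ε x y := by
  have h0 : (fun j : Fin 2 => ![x, y, z] ((0 : Fin 3).succAbove j)) = ![y, z] := by
    funext j; fin_cases j <;> rfl
  have h1 : (fun j : Fin 2 => ![x, y, z] ((1 : Fin 3).succAbove j)) = ![x, z] := by
    funext j; fin_cases j <;> rfl
  have h2 : (fun j : Fin 2 => ![x, y, z] ((2 : Fin 3).succAbove j)) = ![x, y] := by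
    funext j; fin_cases j <;> rfl
  rw [simplicialBoundary_tupleChain h, Fin.sum_univ_three, h0, h1, h2]
  simp [sub_eq_add_neg]

/-- An edge as an element of the space of `1`-chains modulo boundaries. There, unlike in homology,
single edges have a class, and these classes add up along triangles. -/
def edgeClass (F : Type*) [Field F] (ε : ℝ) (x y : X) :
    SimplicialChain F (vietorisRips X ε) 1 ⧸ simplicialBoundaries F (vietorisRips X ε) 1 :=
  Submodule.mkQ _ (edgeChain F ε x y)

theorem edgeClass_add {x y z : X} (hxy : dist x y < ε) (hyz : dist y z < ε)
    (hxz : dist x z < ε) :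
    edgeClass F ε x y + edgeClass F ε y z = edgeClass F ε x z := by
  rw [edgeClass, edgeClass, edgeClass, ← map_add]
  refine (Submodule.Quotient.eq _).2 ⟨tupleChain F ε ![x, y, z], ?_⟩
  rw [simplicialBoundary_triangle (isSmallTuple_triangle hxy hyz hxz)]
  abel

theorem edgeClass_self (x : X) : edgeClass F ε x x = 0 := by
  by_cases h : 0 < ε
  · have h' : dist x x < ε := by rwa [dist_self]
    exact left_eq_add.1 (edgeClass_add (F := F) h' h' h').symm
  · rw [edgeClass, edgeChain, tupleChain_of_not_small, map_zero]
    rw [isSmallTuple_edge, dist_self]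
    exact h

theorem edgeClass_symm {x y : X} (h : dist x y < ε) :
    edgeClass F ε y x = -edgeClass F ε x y := by
  have h0 : dist x x < ε := by
    rw [dist_self]
    exact dist_nonneg.trans_lt h
  have h1 := edgeClass_add (F := F) h (dist_comm x y ▸ h) h0
  rw [edgeClass_self] at h1
  exact (neg_eq_of_add_eq_zero_right h1).symm

end LowDimensional

/-! ### Dimension zero -/

section ZeroDimensional

variable {F : Type*} [Field F] {n : ℕ} [NeZero n] {ε : ℝ}

/-- The function of a `0`-simplex which is one at the vertex `a` and zero at the others. -/
def vertexIndicator (F : Type*) [Field F] (a : ZMod n) (v : Fin 1 → regularPolygon n) : F :=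
  open Classical in if v 0 = polygonVertex a then 1 else 0

theorem evalCochain_vertexIndicator (hε : 0 < ε) (a b : ZMod n) :
    evalCochain ε (vertexIndicator F a) (vertexChain F ε (polygonVertex b)) =
      if b = a then 1 else 0 := by
  rw [evalCochain_tupleChain _ (isSmallTuple_vertex hε _), vertexIndicator]
  simp only [polygonVertex_injective.eq_iff]

/-- Below the side length of the polygon, the complex is discrete. -/
theorem isCocycle_vertexIndicator (hε : ε ≤ chordLength n 1) (a : ZMod n) :
    IsCocycle ε (vertexIndicator F a) := by
  intro v hv
  obtain ⟨b, hb⟩ := polygonVertex_surjective (v 0)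
  obtain ⟨c, hc⟩ := polygonVertex_surjective (v 1)
  have h : v 1 = v 0 := by
    rw [← hb, ← hc]
    by_contra h
    have h1 := chordLength_one_le_dist (fun h' => h (congrArg polygonVertex h') : c ≠ b)
    rw [hb, hc] at h1
    exact absurd (hv 1 0) (hε.trans h1).not_gt
  have h0 : v ((0 : Fin 2).succAbove 0) = v 1 := rfl
  have h1 : v ((1 : Fin 2).succAbove 0) = v 0 := rfl
  rw [Fin.sum_univ_two]
  simp only [vertexIndicator, h0, h1, h]
  rw [← add_mul]
  simp

theorem isCocycle_augmentation {X : Type} [MetricSpace X] :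
    IsCocycle ε (fun _ : Fin 1 → X => (1 : F)) := by
  intro v _
  simp [Fin.sum_univ_two]

/-- The `0`-cycles which freely generate the homology in dimension zero: the vertex `0`, and the
differences between the other vertices and the vertex `0`. -/
def componentChain (F : Type*) [Field F] (ε : ℝ) (a : ZMod n) :
    SimplicialChain F (vietorisRips (regularPolygon n) ε) 0 :=
  if a = 0 then vertexChain F ε (polygonVertex 0)
  else vertexChain F ε (polygonVertex a) - vertexChain F ε (polygonVertex 0)

/-- The interval during which the class of `componentChain F ε a` is nonzero. -/
def componentInterval (n : ℕ) (a : ZMod n) : Set ℝ :=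
  if a = 0 then Set.Ioi 0 else Set.Ioc 0 (chordLength n 1)

/-- Above the side length of the polygon, the complex is connected. -/
theorem vertexChain_sub_mem_boundaries (hε : chordLength n 1 < ε) (hn : 2 ≤ n) (a : ZMod n) :
    vertexChain F ε (polygonVertex a) - vertexChain F ε (polygonVertex 0) ∈
      simplicialBoundaries F (vietorisRips (regularPolygon n) ε) 0 := by
  rw [← ZMod.natCast_zmod_val a]
  induction a.val with
  | zero =>
    rw [Nat.cast_zero, sub_self]
    exact Submodule.zero_mem _
  | succ l ih =>
    have h : dist (polygonVertex (l : ZMod n)) (polygonVertex ((l + 1 : ℕ) : ZMod n)) < ε := by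
      rw [Nat.cast_add, dist_polygonVertex_add hn]
      exact hε
    rw [← sub_add_sub_cancel _ (vertexChain F ε (polygonVertex (l : ZMod n)))]
    exact Submodule.add_mem _ ⟨_, simplicialBoundary_edgeChain h⟩ ih

theorem isBarcode_zero (F : Type*) [Field F] (hn : 2 ≤ n) :
    IsBarcode (ripsPersistentHomology F (regularPolygon n) 0)
      (Finset.univ.val.map (componentInterval n)) := by
  have hpos : 0 < chordLength n 1 := by
    have := chordLength_lt (n := n) zero_lt_one hn
    simpa [chordLength] using this
  refine isBarcode_of_cycles _ ?_ ?_ (componentChain F) (fun _ _ => Submodule.mem_top)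
    ?_ ?_ ?_ ?_
  · intro a
    unfold componentInterval
    split_ifs
    · exact Set.ordConnected_Ioi
    · exact Set.ordConnected_Ioc
  · intro a
    unfold componentInterval
    split_ifs
    · exact Set.nonempty_Ioi
    · exact Set.nonempty_Ioc.2 hpos
  · intro s t hst a hs
    have h0 : 0 < s := by
      unfold componentInterval at hs
      split_ifs at hs
      exacts [hs, hs.1]
    unfold componentChain
    split_ifs
    · exact simplicialChainMap_tupleChain hst (isSmallTuple_vertex h0 _)
    · rw [map_sub, simplicialChainMap_tupleChain hst (isSmallTuple_vertex h0 _),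
        simplicialChainMap_tupleChain hst (isSmallTuple_vertex h0 _)]
  · intro t a ha
    by_cases h0 : 0 < t
    · unfold componentInterval at ha
      split_ifs at ha with h
      · exact absurd h0 ha
      · rw [componentChain, if_neg h]
        refine vertexChain_sub_mem_boundaries ?_ hn a
        by_contra h1
        exact ha ⟨h0, not_lt.1 h1⟩
    · have hv : ∀ x : regularPolygon n, vertexChain F t x = 0 := fun x =>
        tupleChain_of_not_small fun h => h0 (dist_nonneg.trans_lt (h 0 0))
      rw [componentChain, hv, hv, sub_zero, ite_self]
      exact Submodule.zero_mem _
  · intro t z _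
    refine Submodule.mem_sup_left (chain_mem_of_tupleChain_mem _ (fun v _ => ?_) z)
    obtain ⟨a, ha⟩ := polygonVertex_surjective (v 0)
    have hv : v = fun _ => polygonVertex a := by
      funext j
      fin_cases j
      exact ha.symm
    have hS : ∀ b : ZMod n, componentChain F t b ∈
        Submodule.span F (Set.range (componentChain (n := n) F t)) := fun b =>
      Submodule.subset_span ⟨b, rfl⟩
    have h2 := hS 0
    rw [componentChain, if_pos rfl] at h2
    rw [hv]
    by_cases h : a = 0
    · rwa [h]
    · have h1 := hS a
      rw [componentChain, if_neg h] at h1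
      have := Submodule.add_mem _ h1 h2
      rwa [sub_add_cancel] at this
  · intro t a ha
    by_cases h : a = 0
    · have h0 : 0 < t := by
        rwa [componentInterval, if_pos h] at ha
      refine ⟨fun _ => 1, isCocycle_augmentation, ?_, fun b hb => ?_⟩
      · rw [componentChain, if_pos h, evalCochain_tupleChain _ (isSmallTuple_vertex h0 _)]
      · rw [h] at hb
        rw [componentChain, if_neg hb, map_sub,
          evalCochain_tupleChain _ (isSmallTuple_vertex h0 _),
          evalCochain_tupleChain _ (isSmallTuple_vertex h0 _), sub_self]
    · rw [componentInterval, if_neg h] at ha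
      refine ⟨vertexIndicator F a, isCocycle_vertexIndicator ha.2 a, ?_, fun b hb => ?_⟩
      · rw [componentChain, if_neg h, map_sub, evalCochain_vertexIndicator ha.1,
          evalCochain_vertexIndicator ha.1, if_pos rfl, if_neg (Ne.symm h), sub_zero]
      · rw [componentChain]
        split_ifs
        · rw [evalCochain_vertexIndicator ha.1, if_neg (Ne.symm h)]
        · rw [map_sub, evalCochain_vertexIndicator ha.1, evalCochain_vertexIndicator ha.1,
            if_neg hb, if_neg (Ne.symm h), sub_zero]

theorem map_componentInterval :
    (Finset.univ : Finset (ZMod n)).val.map (componentInterval n) =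
      Set.Ioi 0 ::ₘ Multiset.replicate (n - 1) (Set.Ioc 0 (chordLength n 1)) := by
  rw [← Finset.insert_erase (Finset.mem_univ (0 : ZMod n)),
    Finset.insert_val_of_notMem (Finset.notMem_erase _ _), Multiset.map_cons]
  refine congrArg₂ Multiset.cons (if_pos rfl) ?_
  rw [Multiset.map_congr (g := fun _ => Set.Ioc 0 (chordLength n 1)) rfl, Multiset.map_const']
  · congr 1
    rw [Finset.card_val, Finset.card_erase_of_mem (Finset.mem_univ _), Finset.card_univ,
      ZMod.card]
  · intro a ha
    exact if_neg (Finset.ne_of_mem_erase ha)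

end ZeroDimensional

/-! ### Dimension one -/

section OneDimensional

variable {F : Type*} [Field F] {n : ℕ} [NeZero n] {ε : ℝ}

/-- The class modulo boundaries of the side of the polygon which starts at the vertex `a`. -/
def sideClass (F : Type*) [Field F] (ε : ℝ) (a : ZMod n) :
    SimplicialChain F (vietorisRips (regularPolygon n) ε) 1 ⧸
      simplicialBoundaries F (vietorisRips (regularPolygon n) ε) 1 :=
  edgeClass F ε (polygonVertex a) (polygonVertex (a + 1))

/-- The chain which runs once around the polygon; it is zero at scales where the sides are not
edges of the complex. -/
def polygonChain (F : Type*) [Field F] (n : ℕ) [NeZero n] (ε : ℝ) :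
    SimplicialChain F (vietorisRips (regularPolygon n) ε) 1 :=
  ∑ a : ZMod n, edgeChain F ε (polygonVertex a) (polygonVertex (a + 1))

theorem dist_side (hn : 2 ≤ n) (a : ZMod n) :
    dist (polygonVertex a) (polygonVertex (a + 1)) = chordLength n 1 := by
  have := dist_polygonVertex_add (n := n) (m := 1) hn a
  rwa [Nat.cast_one] at this

/-- A chord is homologous, relative to its end points, to the path of sides along the shorter
arc: all chords within this arc are shorter, so that the arc can be filled by triangles. -/
theorem edgeClass_eq_sum_sideClass {m : ℕ} (hm : 2 * m ≤ n) (hε : chordLength n m < ε)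
    (a : ZMod n) :
    edgeClass F ε (polygonVertex a) (polygonVertex (a + (m : ZMod n))) =
      ∑ l ∈ Finset.range m, sideClass F ε (a + (l : ZMod n)) := by
  induction m with
  | zero => rw [Nat.cast_zero, add_zero, edgeClass_self, Finset.sum_range_zero]
  | succ m ih =>
    have h1 : chordLength n m < ε := (chordLength_le (Nat.le_succ m) hm).trans_lt hε
    have h2 : chordLength n 1 < ε := (chordLength_le (by omega) hm).trans_lt hε
    rw [Finset.sum_range_succ, ← ih (by omega) h1, sideClass, Nat.cast_succ, ← add_assoc]
    refine (edgeClass_add ?_ ?_ ?_).symm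
    · rw [dist_polygonVertex_add (by omega)]
      exact h1
    · rw [dist_side (by omega)]
      exact h2
    · rw [add_assoc, ← Nat.cast_succ, dist_polygonVertex_add hm]
      exact hε

theorem polygonChain_mem_cycles (hn : 2 ≤ n) :
    polygonChain F n ε ∈ simplicialCycles F (vietorisRips (regularPolygon n) ε) 1 := by
  change simplicialBoundary F _ 0 (polygonChain F n ε) = 0
  rw [polygonChain, map_sum]
  by_cases hε : chordLength n 1 < ε
  · rw [Finset.sum_congr rfl fun a _ =>
        simplicialBoundary_edgeChain ((dist_side hn a).trans_lt hε),
      Finset.sum_sub_distrib, sub_eq_zero]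
    exact Equiv.sum_comp (Equiv.addRight (1 : ZMod n))
      fun a => vertexChain F ε (polygonVertex a)
  · refine Finset.sum_eq_zero fun a _ => ?_
    rw [edgeChain, tupleChain_of_not_small, map_zero]
    rwa [isSmallTuple_edge, dist_side hn]

/-- Once the sides are edges of the complex, the chain around the polygon spans the homology in
dimension one. -/
theorem exists_sub_smul_polygonChain_mem (hn : 2 ≤ n) (hε : chordLength n 1 < ε)
    {z : SimplicialChain F (vietorisRips (regularPolygon n) ε) 1}
    (hz : z ∈ simplicialCycles F (vietorisRips (regularPolygon n) ε) 1) :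
    ∃ c : F, z - c • polygonChain F n ε ∈
      simplicialBoundaries F (vietorisRips (regularPolygon n) ε) 1 := by
  have h0 : 0 < ε := by
    refine lt_of_le_of_lt ?_ hε
    rw [← dist_side hn 0]
    exact dist_nonneg
  have hspan : (simplicialBoundaries F (vietorisRips (regularPolygon n) ε) 1).mkQ z ∈
      Submodule.span F (Set.range (sideClass (n := n) F ε)) := by
    refine chain_mem_of_tupleChain_mem ((Submodule.span F (Set.range (sideClass F ε))).comap
      (simplicialBoundaries F (vietorisRips (regularPolygon n) ε) 1).mkQ) ?_ z
    intro v hv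
    have key : ∀ (a : ZMod n) (m : ℕ), 2 * m ≤ n → chordLength n m < ε →
        edgeClass F ε (polygonVertex a) (polygonVertex (a + (m : ZMod n))) ∈
          Submodule.span F (Set.range (sideClass (n := n) F ε)) := by
      intro a m hm hmε
      rw [edgeClass_eq_sum_sideClass hm hmε]
      exact Submodule.sum_mem _ fun l _ => Submodule.subset_span ⟨_, rfl⟩
    obtain ⟨a, ha⟩ := polygonVertex_surjective (v 0)
    obtain ⟨b, hb⟩ := polygonVertex_surjective (v 1)
    have hab : dist (polygonVertex a) (polygonVertex b) < ε := by
      rw [ha, hb]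
      exact hv 0 1
    have hvab : v = ![polygonVertex a, polygonVertex b] := by
      funext j
      fin_cases j
      exacts [ha.symm, hb.symm]
    rw [hvab]
    change edgeClass F ε (polygonVertex a) (polygonVertex b) ∈
      Submodule.span F (Set.range (sideClass (n := n) F ε))
    obtain ⟨m, hm, rfl | rfl⟩ := exists_steps a b
    · rw [dist_polygonVertex_add hm] at hab
      exact key a m hm hab
    · rw [dist_comm, dist_polygonVertex_add hm] at hab
      rw [edgeClass_symm (by rwa [dist_polygonVertex_add hm])]
      exact Submodule.neg_mem _ (key b m hm hab)
  obtain ⟨f, hf⟩ := (Submodule.mem_span_range_iff_exists_fun F).1 hspan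
  set c₁ : SimplicialChain F (vietorisRips (regularPolygon n) ε) 1 :=
    ∑ a : ZMod n, f a • edgeChain F ε (polygonVertex a) (polygonVertex (a + 1)) with hc₁
  have hmem : z - c₁ ∈ simplicialBoundaries F (vietorisRips (regularPolygon n) ε) 1 := by
    refine (Submodule.Quotient.eq _).1 ?_
    change Submodule.mkQ _ z = Submodule.mkQ _ c₁
    rw [← hf, hc₁, map_sum]
    exact Finset.sum_congr rfl fun a _ => (map_smul _ _ _).symm
  have hcyc : simplicialBoundary F (vietorisRips (regularPolygon n) ε) 0 c₁ = 0 := by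
    have h1 : simplicialBoundary F _ 0 (z - c₁) = 0 := simplicialBoundaries_le_cycles F _ 1 hmem
    have h2 : simplicialBoundary F _ 0 z = 0 := hz
    rw [map_sub, h2, zero_sub, neg_eq_zero] at h1
    exact h1
  -- The coefficient of the vertex `b` in the boundary of `c₁` is `f (b - 1) - f b`.
  have hstep : ∀ b : ZMod n, f (b - 1) = f b := by
    intro b
    have h1 := congrArg (evalCochain ε (vertexIndicator F b)) hcyc
    rw [hc₁, map_sum, map_sum, map_zero] at h1
    have h2 : ∀ a : ZMod n, evalCochain ε (vertexIndicator F b)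
        (simplicialBoundary F (vietorisRips (regularPolygon n) ε) 0
          (f a • edgeChain F ε (polygonVertex a) (polygonVertex (a + 1)))) =
        (if a = b - 1 then f a else 0) - (if a = b then f a else 0) := by
      intro a
      rw [map_smul, simplicialBoundary_edgeChain ((dist_side hn a).trans_lt hε), map_smul,
        map_sub, evalCochain_vertexIndicator h0, evalCochain_vertexIndicator h0, smul_eq_mul,
        mul_sub]
      simp only [mul_ite, mul_one, mul_zero, eq_sub_iff_add_eq]
    rw [Finset.sum_congr rfl fun a _ => h2 a, Finset.sum_sub_distrib,
      Finset.sum_ite_eq' Finset.univ (b - 1) f, Finset.sum_ite_eq' Finset.univ b f,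
      if_pos (Finset.mem_univ _), if_pos (Finset.mem_univ _), sub_eq_zero] at h1
    exact h1
  have hconst : ∀ b : ZMod n, f b = f 0 := by
    intro b
    rw [← ZMod.natCast_zmod_val b]
    induction b.val with
    | zero => rw [Nat.cast_zero]
    | succ l ih => rw [← hstep, Nat.cast_succ, add_sub_cancel_right, ih]
  refine ⟨f 0, ?_⟩
  rw [polygonChain, Finset.smul_sum]
  simp only [hconst] at hc₁
  rw [← hc₁]
  exact hmem

theorem sum_zmod_eq_sum_range {M : Type*} [AddCommMonoid M] (f : ZMod n → M) :
    ∑ a, f a = ∑ l ∈ Finset.range n, f (l : ZMod n) := by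
  refine Finset.sum_nbij' ZMod.val (fun l => (l : ZMod n)) ?_ ?_ ?_ ?_ ?_
  · exact fun a _ => Finset.mem_range.2 a.val_lt
  · exact fun _ _ => Finset.mem_univ _
  · exact fun a _ => ZMod.natCast_zmod_val a
  · exact fun l hl => ZMod.val_cast_of_lt (Finset.mem_range.1 hl)
  · exact fun a _ => by rw [ZMod.natCast_zmod_val]

/-- Once an inscribed equilateral triangle is a face of the complex, the chain around the polygon
is homologous to the boundary of this triangle. -/
theorem polygonChain_mem_boundaries {k : ℕ} (hn : n = 6 * k) (hε : Real.sqrt 3 < ε) :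
    polygonChain F n ε ∈ simplicialBoundaries F (vietorisRips (regularPolygon n) ε) 1 := by
  have hε' : chordLength n (2 * k) < ε := by rwa [chordLength_third hn]
  have hk : 2 * (2 * k) ≤ n := by omega
  refine (Submodule.Quotient.mk_eq_zero _).1 ?_
  change Submodule.mkQ _ (polygonChain F n ε) = 0
  have h1 : Submodule.mkQ _ (polygonChain F n ε) = ∑ a : ZMod n, sideClass F ε a := by
    rw [polygonChain, map_sum]
    rfl
  have hz : (((2 * k : ℕ) : ZMod n) + ((2 * k : ℕ) : ZMod n)) + ((2 * k : ℕ) : ZMod n) = 0 := by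
    rw [← Nat.cast_add, ← Nat.cast_add, ZMod.natCast_eq_zero_iff]
    exact ⟨1, by omega⟩
  have hr : Finset.range n = Finset.range (2 * k + 2 * k + 2 * k) := by
    congr 1
    omega
  have e1 := edgeClass_eq_sum_sideClass (F := F) hk hε' 0
  have e2 := edgeClass_eq_sum_sideClass (F := F) hk hε' ((2 * k : ℕ) : ZMod n)
  have e3 := edgeClass_eq_sum_sideClass (F := F) hk hε'
    (((2 * k : ℕ) : ZMod n) + ((2 * k : ℕ) : ZMod n))
  have d1 := dist_polygonVertex_add hk (0 : ZMod n)
  have d2 := dist_polygonVertex_add hk ((2 * k : ℕ) : ZMod n)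
  have d3 := dist_polygonVertex_add hk (((2 * k : ℕ) : ZMod n) + ((2 * k : ℕ) : ZMod n))
  rw [zero_add] at e1 d1
  rw [hz] at e3 d3
  rw [h1, sum_zmod_eq_sum_range, hr, Finset.sum_range_add, Finset.sum_range_add]
  simp only [Nat.cast_add, zero_add] at e1 e2 e3 ⊢
  rw [← e1, ← e2, ← e3, edgeClass_add, edgeClass_symm, neg_add_cancel]
  · exact d3.trans_lt hε'
  · exact d1.trans_lt hε'
  · exact d2.trans_lt hε'
  · rw [dist_comm]
    exact d3.trans_lt hε'

/-- Below the side length of the polygon, all edges are degenerate. -/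
theorem chain_mem_boundaries_of_le (hε : ε ≤ chordLength n 1)
    (z : SimplicialChain F (vietorisRips (regularPolygon n) ε) 1) :
    z ∈ simplicialBoundaries F (vietorisRips (regularPolygon n) ε) 1 := by
  refine chain_mem_of_tupleChain_mem _ ?_ z
  intro v hv
  obtain ⟨a, ha⟩ := polygonVertex_surjective (v 0)
  obtain ⟨b, hb⟩ := polygonVertex_surjective (v 1)
  have hab : a = b := by
    by_contra h
    have h1 := chordLength_one_le_dist h
    rw [ha, hb] at h1
    exact absurd (hv 0 1) (hε.trans h1).not_gt
  have hvab : v = ![polygonVertex a, polygonVertex a] := by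
    funext j
    fin_cases j
    exacts [ha.symm, by rw [hab]; exact hb.symm]
  rw [hvab]
  exact (Submodule.Quotient.mk_eq_zero _).1 (edgeClass_self (F := F) (ε := ε) (polygonVertex a))

/-- How often the shorter arc from the vertex `a` to the vertex `b` crosses from the vertex
`n - 1` to the vertex `0`, counted with sign. Between opposite vertices `ZMod.valMinAbs` selects
the counterclockwise arc. -/
def crossingNumber (a b : ZMod n) : ℤ :=
  ((b - a).valMinAbs - ((b.val : ℤ) - a.val)) / n

theorem mul_crossingNumber (a b : ZMod n) :
    (n : ℤ) * crossingNumber a b = (b - a).valMinAbs - ((b.val : ℤ) - a.val) := by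
  refine Int.mul_ediv_cancel' ?_
  rw [← ZMod.intCast_zmod_eq_zero_iff_dvd]
  push_cast
  rw [ZMod.natCast_zmod_val, ZMod.natCast_zmod_val, sub_self]

theorem sum_crossingNumber (hn : 2 ≤ n) : ∑ a : ZMod n, crossingNumber a (a + 1) = 1 := by
  have hn0 : (n : ℤ) ≠ 0 := by exact_mod_cast NeZero.ne n
  have h1 : (1 : ZMod n).valMinAbs = 1 := by
    have := ZMod.valMinAbs_natCast_of_le_half (n := n) (a := 1) (by omega)
    simpa using this
  have h2 : ∑ a : ZMod n, ((a + 1).val : ℤ) = ∑ a : ZMod n, (a.val : ℤ) :=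
    Equiv.sum_comp (Equiv.addRight (1 : ZMod n)) fun a => (a.val : ℤ)
  refine mul_left_cancel₀ hn0 ?_
  rw [Finset.mul_sum, Finset.sum_congr rfl fun a _ => mul_crossingNumber a (a + 1),
    Finset.sum_sub_distrib, Finset.sum_sub_distrib, h2, sub_self, sub_zero, mul_one]
  simp [h1, ZMod.card]

/-- If three vertices are pairwise less than `n / 3` steps apart, then the shorter arcs between
them do not go around the circle. -/
theorem crossingNumber_add {a b c : ZMod n} (hab : 3 * (b - a).valMinAbs.natAbs < n)
    (hbc : 3 * (c - b).valMinAbs.natAbs < n) (hac : 3 * (c - a).valMinAbs.natAbs < n) :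
    crossingNumber b c - crossingNumber a c + crossingNumber a b = 0 := by
  have hn0 : (n : ℤ) ≠ 0 := by exact_mod_cast NeZero.ne n
  have h : (b - a).valMinAbs + (c - b).valMinAbs - (c - a).valMinAbs = 0 := by
    refine Int.eq_zero_of_abs_lt_dvd (m := n) ?_ ?_
    · rw [← ZMod.intCast_zmod_eq_zero_iff_dvd]
      push_cast
      ring
    · rw [abs_lt]
      omega
  refine mul_left_cancel₀ hn0 ?_
  rw [mul_add, mul_sub, mul_crossingNumber, mul_crossingNumber, mul_crossingNumber, mul_zero]
  linarith

/-- The crossing number as a cochain with values in `F`. -/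
def crossingCochain (F : Type*) [Field F] (v : Fin 2 → regularPolygon n) : F :=
  crossingNumber (Function.surjInv polygonVertex_surjective (v 0))
    (Function.surjInv polygonVertex_surjective (v 1))

theorem crossingCochain_edge (a b : ZMod n) :
    crossingCochain F ![polygonVertex a, polygonVertex b] = crossingNumber a b := by
  have h : ∀ a : ZMod n, Function.surjInv polygonVertex_surjective (polygonVertex a) = a :=
    fun a => polygonVertex_injective (Function.surjInv_eq polygonVertex_surjective _)
  change ((crossingNumber (Function.surjInv _ (polygonVertex a))
    (Function.surjInv _ (polygonVertex b)) : ℤ) : F) = _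
  rw [h, h]

theorem isCocycle_crossingCochain {k : ℕ} (hn : n = 6 * k) (hε : ε ≤ Real.sqrt 3) :
    IsCocycle ε (crossingCochain (n := n) F) := by
  intro v hv
  have h : ∀ i j, 3 * (Function.surjInv polygonVertex_surjective (v j) -
      Function.surjInv polygonVertex_surjective (v i)).valMinAbs.natAbs < n := by
    intro i j
    refine three_mul_natAbs_lt hn ?_
    rw [Function.surjInv_eq polygonVertex_surjective,
      Function.surjInv_eq polygonVertex_surjective]
    exact (hv i j).trans_le hε
  have h1 := congrArg (Int.cast (R := F)) (crossingNumber_add (h 0 1) (h 1 2) (h 0 2))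
  push_cast at h1
  rw [Fin.sum_univ_three, ← h1]
  have e : ∀ i j : Fin 3, (crossingNumber (Function.surjInv polygonVertex_surjective (v i))
    (Function.surjInv polygonVertex_surjective (v j)) : F) = crossingCochain F ![v i, v j] :=
    fun _ _ => rfl
  have h0 : (fun j : Fin 2 => v ((0 : Fin 3).succAbove j)) = ![v 1, v 2] := by
    funext j; fin_cases j <;> rfl
  have h1 : (fun j : Fin 2 => v ((1 : Fin 3).succAbove j)) = ![v 0, v 2] := by
    funext j; fin_cases j <;> rfl
  have h2 : (fun j : Fin 2 => v ((2 : Fin 3).succAbove j)) = ![v 0, v 1] := by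
    funext j; fin_cases j <;> rfl
  rw [h0, h1, h2, e, e, e]
  simp [sub_eq_add_neg]

theorem evalCochain_crossingCochain (hn : 2 ≤ n) (hε : chordLength n 1 < ε) :
    evalCochain ε (crossingCochain F) (polygonChain F n ε) = 1 := by
  rw [polygonChain, map_sum]
  have h := congrArg (Int.cast (R := F)) (sum_crossingNumber hn)
  push_cast at h
  rw [← h]
  refine Finset.sum_congr rfl fun a _ => ?_
  rw [evalCochain_tupleChain _ (isSmallTuple_edge.2 ((dist_side hn a).trans_lt hε)),
    crossingCochain_edge]

theorem isBarcode_one (F : Type*) [Field F] {k : ℕ} (hn : n = 6 * k) :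
    IsBarcode (ripsPersistentHomology F (regularPolygon n) 1)
      {Set.Ioc (chordLength n 1) (Real.sqrt 3)} := by
  have hk : k ≠ 0 := by
    have := NeZero.ne n
    omega
  have hn2 : 2 ≤ n := by omega
  refine isBarcode_of_cycles (ι := Unit) (fun _ => Set.Ioc (chordLength n 1) (Real.sqrt 3))
    (fun _ => Set.ordConnected_Ioc) (fun _ => Set.nonempty_Ioc.2 ?_)
    (fun t _ => polygonChain F n t) (fun _ _ => polygonChain_mem_cycles hn2) ?_ ?_ ?_ ?_
  · rw [← chordLength_third hn]
    exact chordLength_lt (by omega) (by omega)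
  · intro s t hst _ hs
    rw [polygonChain, map_sum]
    exact Finset.sum_congr rfl fun a _ => simplicialChainMap_tupleChain hst
      (isSmallTuple_edge.2 ((dist_side hn2 a).trans_lt hs.1))
  · intro t _ ht
    by_cases h : t ≤ chordLength n 1
    · exact chain_mem_boundaries_of_le h _
    · refine polygonChain_mem_boundaries hn ?_
      by_contra h'
      exact ht ⟨not_le.1 h, not_lt.1 h'⟩
  · intro t z hz
    by_cases h : t ≤ chordLength n 1
    · exact Submodule.mem_sup_right (chain_mem_boundaries_of_le h z)
    · obtain ⟨c, hc⟩ := exists_sub_smul_polygonChain_mem hn2 (not_le.1 h) hz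
      rw [← add_sub_cancel (c • polygonChain F n t) z]
      exact Submodule.add_mem_sup
        (Submodule.smul_mem _ c (Submodule.subset_span ⟨(), rfl⟩)) hc
  · intro t _ ht
    exact ⟨crossingCochain F, isCocycle_crossingCochain hn ht.2,
      evalCochain_crossingCochain hn2 ht.1, fun j hj => absurd rfl hj⟩

end OneDimensional

end

theorem theoremC1 (F : Type*) [Field F] (n k : ℕ) (hk : 1 ≤ k) (hn : n = 6 * k) :
    IsBarcode (ripsPersistentHomology F (regularPolygon n) 0)
      (Set.Ioi 0 ::ₘ Multiset.replicate (n - 1) (Set.Ioc 0 (2 * Real.sin (Real.pi / n)))) ∧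
    IsBarcode (ripsPersistentHomology F (regularPolygon n) 1)
      {Set.Ioc (2 * Real.sin (Real.pi / n)) (Real.sqrt 3)} := by
  have : NeZero n := ⟨by omega⟩
  rw [← chordLength_one]
  refine ⟨?_, isBarcode_one F hn⟩
  rw [← map_componentInterval]
  exact isBarcode_zero F (by omega)
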